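/- Let $S$ be a smooth (Hausdorff) surface and let $f:S\to H^3$ be a smooth immersion into hyperbolic 3-space, equipped with a smooth unit normal vector field $N$. Let $I$ be the induced metric, $\nabla$ its Levi-Civita connection, $K$ its Gauss curvature, $B$ the shape operator of $S$ ($Bx=-\nabla^{H^3}_xN$), $H=\operatorname{tr}B$, $K_e=\det B$, and let $E$ be the identity of $TS$. Suppose that $E+B$ is invertible at every point of $S$. Put $$I^*=\tfrac12 I\big((E+B)\cdot,(E+B)\cdot\big),\qquad B^*=(E+B)^{-1}(E-B),\qquad H^*=\operatorname{tr}B^*.$$ Then $I^*$ is a smooth Riemannian metric on $S$, and: 1. the Levi-Civita connection of $I^*$ is $\nabla^*_xy=(E+B)^{-1}\nabla_x\big((E+B)y\big)$; 2. the Gauss curvature of $I^*$ is $K^*=\dfrac{2K}{1+H+K_e}$; 3. $H^*=-K^*$; 4. $d^{\nabla^*}B^*=0$, i.e. $\nabla^*_x(B^*y)-\nabla^*_y(B^*x)-B^*[x,y]=0$ for all vector fields $x,y$ on $S$. -/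

import Mathlib

open scoped Manifold ContDiff

noncomputable section

/-! ### The hyperboloid model of hyperbolic space -/

/-- The ambient vector space `ℝ⁴` of the hyperboloid model. -/
abbrev MinkowskiSpace : Type := Fin 4 → ℝ

/-- The Lorentzian scalar product `⟪v, w⟫ = - v₀ w₀ + v₁ w₁ + v₂ w₂ + v₃ w₃`. -/
def lorentz (v w : MinkowskiSpace) : ℝ :=
  -(v 0 * w 0) + v 1 * w 1 + v 2 * w 2 + v 3 * w 3

/-- Hyperbolic 3-space `H³`: the upper sheet of `⟪p, p⟫ = -1`. Its tangent space at `p` is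
the Lorentz-orthogonal complement of `p`, and its metric is the restriction of `lorentz`. -/
def hyperbolicSpace : Set MinkowskiSpace :=
  {p | lorentz p p = -1 ∧ 0 < p 0}

/-- The model vector space of surfaces. -/
abbrev Plane : Type := EuclideanSpace ℝ (Fin 2)

/-- The tangent space of a surface. -/
abbrev Tan {S : Type*} [TopologicalSpace S] [ChartedSpace Plane S] (x : S) : Type :=
  TangentSpace (𝓡 2) x

/-- The differential at `x` of a map with values in a normed vector space, with values in that
vector space. -/
abbrev diff {S : Type*} [TopologicalSpace S] [ChartedSpace Plane S]
    {V : Type*} [NormedAddCommGroup V] [NormedSpace ℝ V] (φ : S → V) (x : S) : Tan x →L[ℝ] V :=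
  mvfderiv (𝓡 2) φ x

/-- A smooth immersed surface `f : S → H³`, with a smooth field `normal` of unit normal vectors. -/
structure ImmersedSurface (S : Type*) [TopologicalSpace S] [ChartedSpace Plane S] where
  /-- The immersion. -/
  f : S → MinkowskiSpace
  /-- The unit normal vector field. -/
  normal : S → MinkowskiSpace
  f_smooth : ContMDiff (𝓡 2) 𝓘(ℝ, MinkowskiSpace) ∞ f
  f_mem : ∀ x, f x ∈ hyperbolicSpace
  f_immersion : ∀ x, Function.Injective (diff f x)
  normal_smooth : ContMDiff (𝓡 2) 𝓘(ℝ, MinkowskiSpace) ∞ normal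
  /-- `normal x` is tangent to `H³` at `f x`. -/
  normal_tangent : ∀ x, lorentz (normal x) (f x) = 0
  normal_unit : ∀ x, lorentz (normal x) (normal x) = 1
  normal_orthogonal : ∀ x (u : Tan x), lorentz (normal x) (diff f x u) = 0

/-! ### Riemannian metrics, connections and curvature on a surface -/

section Intrinsic

variable {S : Type*} [TopologicalSpace S] [ChartedSpace Plane S]

instance tanFiniteDimensional (x : S) : FiniteDimensional ℝ (Tan x) :=
  inferInstanceAs (FiniteDimensional ℝ Plane)

instance tanT2Space (x : S) : T2Space (Tan x) :=
  inferInstanceAs (T2Space Plane)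

/-- Fields `g` of bilinear forms on `S`. -/
abbrev FormField (S : Type*) [TopologicalSpace S] [ChartedSpace Plane S] : Type _ :=
  (x : S) → Tan x →ₗ[ℝ] Tan x →ₗ[ℝ] ℝ

/-- Vector fields on `S`, of arbitrary regularity. -/
abbrev VField (S : Type*) [TopologicalSpace S] [ChartedSpace Plane S] : Type _ :=
  (x : S) → Tan x

/-- The type of (the operator underlying) a connection on `TS`: for a vector field `Y`,
`nabla Y x u` is `∇_u Y`, where `u` is a tangent vector at `x`. -/
abbrev ConnOperator (S : Type*) [TopologicalSpace S] [ChartedSpace Plane S] : Type _ :=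
  VField S → (x : S) → Tan x →L[ℝ] Tan x

/-- The vector field `Y` is differentiable at `x`. -/
abbrev VField.DiffAt [IsManifold (𝓡 2) ∞ S] (Y : VField S) (x : S) : Prop :=
  MDifferentiableAt (𝓡 2) (𝓡 2).tangent
    (fun y ↦ (Bundle.TotalSpace.mk' Plane y (Y y) : TangentBundle (𝓡 2) S)) x

/-- The vector field `Y` is smooth. -/
abbrev VField.Smooth [IsManifold (𝓡 2) ∞ S] (Y : VField S) (s : Set S) : Prop :=
  ContMDiffOn (𝓡 2) (𝓡 2).tangent ∞
    (fun y ↦ (Bundle.TotalSpace.mk' Plane y (Y y) : TangentBundle (𝓡 2) S)) s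

/-- `g` is a smooth Riemannian metric. -/
structure IsSmoothMetric [IsManifold (𝓡 2) ∞ S] (g : FormField S) : Prop where
  symm : ∀ x (u v : Tan x), g x u v = g x v u
  pos : ∀ x (u : Tan x), u ≠ 0 → 0 < g x u u
  smooth : ∀ (U : Set S), IsOpen U → ∀ Y Z : VField S, Y.Smooth U → Z.Smooth U →
    ContMDiffOn (𝓡 2) 𝓘(ℝ, ℝ) ∞ (fun y ↦ g y (Y y) (Z y)) U

/-- `nabla` is the Levi-Civita connection of `g`: it is a connection (additive, and satisfying the
Leibniz rule), it is compatible with `g`, and it is torsion-free. -/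
structure IsLeviCivita [IsManifold (𝓡 2) ∞ S] (g : FormField S) (nabla : ConnOperator S) :
    Prop where
  connection : IsCovariantDerivativeOn (I := 𝓡 2) (V := (TangentSpace (𝓡 2) : S → Type _))
    Plane nabla Set.univ
  metric : ∀ (Y Z : VField S) (x : S), Y.DiffAt x → Z.DiffAt x → ∀ u : Tan x,
    diff (fun y ↦ g y (Y y) (Z y)) x u = g x (nabla Y x u) (Z x) + g x (Y x) (nabla Z x u)
  torsion_free : ∀ (X Y : VField S) (x : S), X.DiffAt x → Y.DiffAt x →
    nabla Y x (X x) - nabla X x (Y x) = VectorField.mlieBracket (𝓡 2) X Y x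

/-- The curvature `R(X, Y) Z = ∇_X ∇_Y Z - ∇_Y ∇_X Z - ∇_[X, Y] Z` at `x`. -/
def riemannCurvature (nabla : ConnOperator S) (X Y Z : VField S) (x : S) : Tan x :=
  nabla (fun y ↦ nabla Z y (Y y)) x (X x) - nabla (fun y ↦ nabla Z y (X y)) x (Y x)
    - nabla Z x (VectorField.mlieBracket (𝓡 2) X Y x)

/-- The `i`-th coordinate vector field of the preferred chart at `x`. -/
def coordField [IsManifold (𝓡 2) ∞ S] (x : S) (i : Fin 2) : VField S :=
  fun y ↦ FiberBundle.extend (E := (TangentSpace (𝓡 2) : S → Type _)) Plane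
    (show Tan x from EuclideanSpace.single i (1 : ℝ)) y

/-- The Gauss curvature `g(R(X, Y) Y, X) / (g(X, X) g(Y, Y) - g(X, Y)²)` at `x` of the metric `g`
with Levi-Civita connection `nabla`, computed in the coordinate frame `X, Y` of the chart
at `x`. -/
def gaussCurvature [IsManifold (𝓡 2) ∞ S] (g : FormField S) (nabla : ConnOperator S) (x : S) :
    ℝ :=
  let X := coordField x 0
  let Y := coordField x 1
  g x (riemannCurvature nabla X Y Y x) (X x) /
    (g x (X x) (X x) * g x (Y x) (Y x) - g x (X x) (Y x) ^ 2)

/-- The exterior covariant derivative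
`(d^∇ A)(X, Y) = ∇_X (A Y) - ∇_Y (A X) - A [X, Y]` at `x` of a field `A` of endomorphisms. -/
def extCovDeriv (nabla : ConnOperator S) (A : (x : S) → Tan x →L[ℝ] Tan x) (X Y : VField S)
    (x : S) : Tan x :=
  nabla (fun y ↦ A y (Y y)) x (X x) - nabla (fun y ↦ A y (X y)) x (Y x)
    - A x (VectorField.mlieBracket (𝓡 2) X Y x)

/-- The operator `Y ↦ A⁻¹ ∇ (A Y)`, for a field `A` of automorphisms. -/
def conjConn (A : (x : S) → Tan x →L[ℝ] Tan x) (nabla : ConnOperator S) : ConnOperator S :=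
  fun Y x ↦ Ring.inverse (A x) ∘L nabla (fun y ↦ A y (Y y)) x

end Intrinsic

/-! ### Extrinsic geometry of surfaces in `H³` -/

namespace ImmersedSurface

variable {S : Type*} [TopologicalSpace S] [ChartedSpace Plane S] (F : ImmersedSurface S)

/-- The Levi-Civita connection of `H³`, for vector fields `V` along the surface: `∇_u V` is the
orthogonal projection of `dV(u)` to the tangent space of `H³` at `f x`. -/
def ambientDeriv (V : S → MinkowskiSpace) (x : S) : Tan x →ₗ[ℝ] MinkowskiSpace where
  toFun u := diff V x u + lorentz (diff V x u) (F.f x) • F.f x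
  map_add' u v := by
    ext i
    simp only [lorentz, map_add, Pi.add_apply, Pi.smul_apply, smul_eq_mul]
    ring
  map_smul' c u := by
    ext i
    simp only [lorentz, map_smul, Pi.add_apply, Pi.smul_apply, smul_eq_mul, RingHom.id_apply]
    ring

/-- The induced metric (first fundamental form) `I(u, v) = ⟪df u, df v⟫`. -/
def I : FormField S := fun x ↦
  LinearMap.mk₂ ℝ (fun u v ↦ lorentz (diff F.f x u) (diff F.f x v))
    (by intros; simp only [lorentz, map_add, Pi.add_apply]; ring)
    (by intros; simp only [lorentz, map_smul, Pi.smul_apply, smul_eq_mul]; ring)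
    (by intros; simp only [lorentz, map_add, Pi.add_apply]; ring)
    (by intros; simp only [lorentz, map_smul, Pi.smul_apply, smul_eq_mul]; ring)

/-- The shape operator `B u = - ∇_u N`, where `N` is the unit normal. The vector `∇_u N` is
tangent to the surface, and a left inverse of the injective map `df` takes it back to `TS`
(see `diff_f_B` below). -/
def B (x : S) : Tan x →L[ℝ] Tan x :=
  LinearMap.toContinuousLinearMap
    ((diff F.f x).toLinearMap.leftInverse ∘ₗ (-F.ambientDeriv F.normal x))

/-- The derivative of the scalar product of two vector-valued functions. -/
theorem diff_lorentz {V W : S → MinkowskiSpace} {x : S}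
    (hV : MDifferentiableAt (𝓡 2) 𝓘(ℝ, MinkowskiSpace) V x)
    (hW : MDifferentiableAt (𝓡 2) 𝓘(ℝ, MinkowskiSpace) W x) (u : Tan x) :
    diff (fun y ↦ lorentz (V y) (W y)) x u
      = lorentz (diff V x u) (W x) + lorentz (V x) (diff W x u) := by
  have hc : ∀ {V : S → MinkowskiSpace}, MDifferentiableAt (𝓡 2) 𝓘(ℝ, MinkowskiSpace) V x →
      ∀ i, HasMFDerivAt (𝓡 2) 𝓘(ℝ, ℝ) (fun y ↦ V y i) x
        ((ContinuousLinearMap.proj (R := ℝ) (φ := fun _ : Fin 4 ↦ ℝ) i) ∘L (diff V x)) := by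
    intro V hV i
    exact ((ContinuousLinearMap.proj (R := ℝ) (φ := fun _ : Fin 4 ↦ ℝ) i).hasMFDerivAt).comp x
      hV.hasMFDerivAt
  have hm := fun i ↦ (hc hV i).mul (hc hW i)
  have h := ((((hm 0).neg).add (hm 1)).add (hm 2)).add (hm 3)
  have h' : HasMFDerivAt (𝓡 2) 𝓘(ℝ, ℝ) (fun y ↦ lorentz (V y) (W y)) x _ := h
  have e := h'.mfderiv
  have e' : diff (fun y ↦ lorentz (V y) (W y)) x u =
    mfderiv (𝓡 2) 𝓘(ℝ, ℝ) (fun y ↦ lorentz (V y) (W y)) x u := rfl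
  rw [e', e]
  change -(V x 0 * diff W x u 0 + W x 0 * diff V x u 0)
    + (V x 1 * diff W x u 1 + W x 1 * diff V x u 1)
    + (V x 2 * diff W x u 2 + W x 2 * diff V x u 2)
    + (V x 3 * diff W x u 3 + W x 3 * diff V x u 3) = _
  simp only [lorentz]
  ring

/-- `∇_u N` is tangent to the surface, so that `B` is characterized by `df (B u) = - ∇_u N`. -/
theorem diff_f_B (x : S) (u : Tan x) :
    diff F.f x (F.B x u) = -F.ambientDeriv F.normal x u := by
  have hf : MDifferentiableAt (𝓡 2) 𝓘(ℝ, MinkowskiSpace) F.f x :=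
    F.f_smooth.mdifferentiableAt (by simp)
  have hn : MDifferentiableAt (𝓡 2) 𝓘(ℝ, MinkowskiSpace) F.normal x :=
    F.normal_smooth.mdifferentiableAt (by simp)
  have hconst : ∀ c : ℝ, diff (fun _ : S ↦ c) x = 0 := fun c ↦
    (hasMFDerivAt_const c x).mfderiv
  have h2 := diff_lorentz hn hn u
  have h3 := fun v ↦ diff_lorentz hf hf v
  simp only [F.normal_unit, fun y ↦ (F.f_mem y).1, hconst] at h2 h3
  have hff := (F.f_mem x).1
  have hnf := F.normal_tangent x
  have hnn := F.normal_unit x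
  have hcomm : ∀ v w, lorentz v w = lorentz w v := fun v w ↦ by simp only [lorentz]; ring
  let L : MinkowskiSpace →ₗ[ℝ] ℝ × ℝ :=
    { toFun := fun v ↦ (lorentz v (F.f x), lorentz v (F.normal x))
      map_add' := fun v w ↦ by
        ext <;> simp only [lorentz, Pi.add_apply, Prod.mk_add_mk] <;> ring
      map_smul' := fun c w ↦ by
        ext <;> simp only [lorentz, Pi.smul_apply, smul_eq_mul, RingHom.id_apply,
          Prod.smul_mk] <;> ring }
  have hL : ∀ v, L v = (lorentz v (F.f x), lorentz v (F.normal x)) := fun _ ↦ rfl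
  have hsurj : Function.Surjective L := by
    rintro ⟨a, b⟩
    refine ⟨(-a) • F.f x + b • F.normal x, ?_⟩
    rw [map_add, map_smul, map_smul, hL, hL, hff, hnf, hnn, hcomm (F.f x), hnf]
    ext <;> simp
  have hker : Module.finrank ℝ (LinearMap.ker L) = 2 := by
    have h := L.finrank_range_add_finrank_ker
    rw [LinearMap.range_eq_top.2 hsurj, finrank_top] at h
    simp at h
    omega
  have hle : LinearMap.range (diff F.f x).toLinearMap ≤ LinearMap.ker L := by
    rintro _ ⟨v, rfl⟩
    rw [LinearMap.mem_ker, hL]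
    have a := h3 v
    have b := F.normal_orthogonal x v
    rw [hcomm (F.f x)] at a
    rw [hcomm] at b
    ext
    · simp at a ⊢
      linarith
    · simpa using b
  have hr : Module.finrank ℝ (LinearMap.range (diff F.f x).toLinearMap) = 2 := by
    rw [LinearMap.finrank_range_of_inj (F.f_immersion x)]
    exact (finrank_euclideanSpace_fin : Module.finrank ℝ Plane = 2)
  have heq := Submodule.eq_of_le_of_finrank_eq hle (hr.trans hker.symm)
  have hmem : -F.ambientDeriv F.normal x u ∈ LinearMap.range (diff F.f x).toLinearMap := by
    rw [heq]
    apply Submodule.neg_mem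
    have e : F.ambientDeriv F.normal x u
        = diff F.normal x u + lorentz (diff F.normal x u) (F.f x) • F.f x := rfl
    rw [LinearMap.mem_ker, e, map_add, map_smul, hL, hL, hff, hcomm (F.f x), hnf]
    rw [hcomm (F.normal x)] at h2
    ext
    · simp
    · simp at h2 ⊢
      linarith
  obtain ⟨v, hv⟩ := hmem
  have hB : F.B x u = (diff F.f x).toLinearMap.leftInverse (-F.ambientDeriv F.normal x u) := rfl
  rw [hB, ← hv, LinearMap.leftInverse_apply_of_inj (LinearMap.ker_eq_bot.2 (F.f_immersion x))]
  rfl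

/-- The mean curvature `H = tr B`. -/
def H (x : S) : ℝ := LinearMap.trace ℝ (Tan x) (F.B x).toLinearMap

/-- The extrinsic curvature `K_e = det B`. -/
def Ke (x : S) : ℝ := LinearMap.det (F.B x).toLinearMap

/-- The field of endomorphisms `E + B`, where `E` is the identity. -/
def EaddB (x : S) : Tan x →L[ℝ] Tan x := 1 + F.B x

/-- The field of endomorphisms `E - B`, where `E` is the identity. -/
def EsubB (x : S) : Tan x →L[ℝ] Tan x := 1 - F.B x

/-- The metric at infinity `I* = ½ I((E + B)·, (E + B)·)`. -/
def IStar : FormField S := fun x ↦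
  (1 / 2 : ℝ) • (F.I x).compl₁₂ (F.EaddB x).toLinearMap (F.EaddB x).toLinearMap

/-- The shape operator at infinity `B* = (E + B)⁻¹ (E - B)`. -/
def BStar (x : S) : Tan x →L[ℝ] Tan x := Ring.inverse (F.EaddB x) * F.EsubB x

/-- The mean curvature at infinity `H* = tr B*`. -/
def HStar (x : S) : ℝ := LinearMap.trace ℝ (Tan x) (F.BStar x).toLinearMap

end ImmersedSurface

end

/-!
The metric at infinity is the metric induced by a map into the light cone. Let `φ = f - N` and
`ψ = f + N`, as maps from `S` to `ℝ⁴`. Weingarten's equation `dN = -df ∘ B` gives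
`dφ = df ∘ (E + B)` and `dψ = df ∘ (E - B)`, so that `I* = ½ ⟪dφ, dφ⟫` and `dφ ∘ B* = dψ`.
All maps in sight thus have differentials with values in the tangent planes `df(T_x S)`; maps with
this property are called parallel here (`ImmersedSurface.IsParallel`).

For a parallel immersion `φ`, projecting the derivative of `dφ(Y)` to the tangent plane and pulling
the result back by `dφ` defines a connection (`ImmersedSurface.IsInducedConn`), which is the
Levi-Civita connection of `c ⟪dφ, dφ⟫` for every `c > 0`: it is metric because the projection is
orthogonal, and torsion-free because `X(dφ(Y)) - Y(dφ(X)) = dφ([X, Y])` (`diff_mlieBracket`). Since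
Levi-Civita connections are unique on differentiable fields (`IsLeviCivita.eq_of_pos`), every
statement may be checked on these induced connections:

* the connection induced by `f - N` is the conjugate by `E + B` of the one induced by `f`, directly
  from the definition (`IsInducedConn.conjConn`);
* `dφ` of `d^{∇*} B*` is the projection of `X(dψ(Y)) - Y(dψ(X)) - dψ([X, Y])`, which vanishes
  (`IsInducedConn.extCovDeriv_eq_zero`);
* if `dφ = df ∘ C`, the identity `X(dW(Y)) - Y(dW(X)) = dW([X, Y])` for `W = dφ(Z)` gives Gauss's
  equation, and the Gauss curvature of `c ⟪dφ, dφ⟫` is `(det B - 1) / (c det C)`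
  (`IsInducedConn.gaussCurvature_eq`). Taking `C = E`, `c = 1` and `C = E + B`, `c = ½` gives `K`
  and `K*`;
* in dimension two, `det (E + B) = 1 + H + K_e` and `det (E + B) tr B* = 2 (1 - K_e)`.

A vector field is differentiable if and only if its image under the differential of an immersion
is (`VField.DiffAt.diff_apply`, `VField.DiffAt.of_diff_apply`), which is how regularity of fields
such as `B Y`, `(E + B)⁻¹ Y` or `∇_Y Z` is established.
-/

noncomputable section

/-! ### Differentials of vector-valued functions on a surface -/

section Calculus

open VectorField Filter Topology

variable {S : Type*} [TopologicalSpace S] [ChartedSpace Plane S]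
  {V : Type*} [NormedAddCommGroup V] [NormedSpace ℝ V]

theorem eventually_mem_extChartAt_source (x : S) :
    ∀ᶠ y in 𝓝 x, y ∈ (extChartAt (𝓡 2) x).source :=
  extChartAt_source_mem_nhds x

theorem diff_congr {φ ψ : S → V} {x : S} (h : φ =ᶠ[𝓝 x] ψ) :
    diff φ x = diff ψ x := by
  have := h.mfderiv_eq (I := 𝓡 2) (I' := 𝓘(ℝ, V))
  ext u
  exact DFunLike.congr_fun this u

/-- The matrix of the differential in the chart at `x` is smooth near `x`. -/
theorem contMDiffAt_fderiv_chart {φ : S → V} {x : S}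
    (hφ : ContMDiffAt (𝓡 2) 𝓘(ℝ, V) ∞ φ x) :
    ContMDiffAt (𝓡 2) 𝓘(ℝ, Plane →L[ℝ] V) ∞
      (fun y ↦ fderiv ℝ (φ ∘ (extChartAt (𝓡 2) x).symm) (extChartAt (𝓡 2) x y)) x := by
  have h1 : ContDiffAt ℝ ∞ (φ ∘ (extChartAt (𝓡 2) x).symm) (extChartAt (𝓡 2) x x) := by
    have := (contMDiffAt_iff.1 hφ).2
    rw [ModelWithCorners.range_eq_univ, contDiffWithinAt_univ] at this
    exact this
  have h2 : ContDiffAt ℝ ∞ (fderiv ℝ (φ ∘ (extChartAt (𝓡 2) x).symm)) (extChartAt (𝓡 2) x x) :=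
    h1.fderiv_right (by simp)
  exact h2.contMDiffAt.comp x contMDiffAt_extChartAt

variable [IsManifold (𝓡 2) ∞ S]

theorem mdifferentiableAt_chart_repr {φ : S → V} {x y : S}
    (hy : y ∈ (extChartAt (𝓡 2) x).source) (hφ : MDifferentiableAt (𝓡 2) 𝓘(ℝ, V) φ y) :
    DifferentiableAt ℝ (φ ∘ (extChartAt (𝓡 2) x).symm) (extChartAt (𝓡 2) x y) := by
  have h1 : MDifferentiableAt 𝓘(ℝ, Plane) (𝓡 2) (extChartAt (𝓡 2) x).symm
      (extChartAt (𝓡 2) x y) := by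
    have := mdifferentiableWithinAt_extChartAt_symm (I := 𝓡 2)
      ((extChartAt (𝓡 2) x).map_source hy)
    rwa [ModelWithCorners.range_eq_univ, mdifferentiableWithinAt_univ] at this
  rw [← mdifferentiableAt_iff_differentiableAt]
  exact hφ.comp_of_eq _ h1 ((extChartAt (𝓡 2) x).left_inv hy)

/-- The differential computed in the chart at a base point `x`. -/
theorem diff_eq_fderiv_chart {φ : S → V} {x y : S} (hy : y ∈ (extChartAt (𝓡 2) x).source)
    (hφ : MDifferentiableAt (𝓡 2) 𝓘(ℝ, V) φ y) (u : Tan y) :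
    diff φ y u = fderiv ℝ (φ ∘ (extChartAt (𝓡 2) x).symm) (extChartAt (𝓡 2) x y)
      (mfderiv (𝓡 2) 𝓘(ℝ, Plane) (extChartAt (𝓡 2) x) y u) := by
  have h1 := (mdifferentiableAt_chart_repr hy hφ).mdifferentiableAt
  have h2 : MDifferentiableAt (𝓡 2) 𝓘(ℝ, Plane) (extChartAt (𝓡 2) x) y :=
    mdifferentiableAt_extChartAt (by simpa using hy)
  have h3 : φ =ᶠ[𝓝 y] (φ ∘ (extChartAt (𝓡 2) x).symm) ∘ extChartAt (𝓡 2) x := by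
    filter_upwards [(isOpen_extChartAt_source x).mem_nhds hy] with z hz
    exact congrArg φ ((extChartAt (𝓡 2) x).left_inv hz).symm
  rw [diff_congr h3, ← mfderiv_eq_fderiv]
  exact mfderiv_comp_apply y h1 h2 u

theorem trivializationAt_snd_eq_mfderiv {x y : S} (hy : y ∈ (extChartAt (𝓡 2) x).source)
    (u : Tan y) :
    (trivializationAt Plane (TangentSpace (𝓡 2)) x
      (Bundle.TotalSpace.mk' Plane y u)).2 =
      mfderiv (𝓡 2) 𝓘(ℝ, Plane) (extChartAt (𝓡 2) x) y u := by
  have hy' : y ∈ (chartAt Plane x).source := by simpa using hy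
  refine Eq.trans ?_ (DFunLike.congr_fun
    (TangentBundle.continuousLinearMapAt_trivializationAt (I := 𝓡 2) hy') u)
  exact (Bundle.Trivialization.continuousLinearMapAt_apply_of_mem ℝ _
    (by simpa using hy') u).symm

theorem ContMDiffAt.eventually_mdifferentiableAt {φ : S → V} {x : S}
    (hφ : ContMDiffAt (𝓡 2) 𝓘(ℝ, V) ∞ φ x) :
    ∀ᶠ y in 𝓝 x, MDifferentiableAt (𝓡 2) 𝓘(ℝ, V) φ y := by
  have h1 : ContMDiffAt (𝓡 2) 𝓘(ℝ, V) 1 φ x := hφ.of_le (by exact_mod_cast le_top)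
  filter_upwards [(contMDiffAt_iff_contMDiffAt_nhds (by simp)).1 h1] with y hy
    using hy.mdifferentiableAt (by simp)

theorem eventually_diff_eq {φ : S → V} {x : S} (hφ : ContMDiffAt (𝓡 2) 𝓘(ℝ, V) ∞ φ x)
    (Y : VField S) :
    ∀ᶠ y in 𝓝 x, diff φ y (Y y) =
      fderiv ℝ (φ ∘ (extChartAt (𝓡 2) x).symm) (extChartAt (𝓡 2) x y)
        (trivializationAt Plane (TangentSpace (𝓡 2)) x (Bundle.TotalSpace.mk' Plane y (Y y))).2 := by
  filter_upwards [hφ.eventually_mdifferentiableAt, eventually_mem_extChartAt_source x] with y h1 h2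
  rw [diff_eq_fderiv_chart h2 h1, trivializationAt_snd_eq_mfderiv h2]

theorem ContMDiffAt.diff_apply {φ : S → V} {x : S} (hφ : ContMDiffAt (𝓡 2) 𝓘(ℝ, V) ∞ φ x)
    {Y : VField S} (hY : ContMDiffAt (𝓡 2) (𝓡 2).tangent ∞
      (fun y ↦ (Bundle.TotalSpace.mk' Plane y (Y y) : TangentBundle (𝓡 2) S)) x) :
    ContMDiffAt (𝓡 2) 𝓘(ℝ, V) ∞ (fun y ↦ diff φ y (Y y)) x := by
  have hY' := (Bundle.contMDiffAt_section x).1 hY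
  exact ((contMDiffAt_fderiv_chart hφ).clm_apply hY').congr_of_eventuallyEq
    (eventually_diff_eq hφ Y)

theorem VField.DiffAt.diff_apply {φ : S → V} {x : S} (hφ : ContMDiffAt (𝓡 2) 𝓘(ℝ, V) ∞ φ x)
    {Y : VField S} (hY : Y.DiffAt x) :
    MDifferentiableAt (𝓡 2) 𝓘(ℝ, V) (fun y ↦ diff φ y (Y y)) x := by
  have hY' := (mdifferentiableAt_section _ Y).1 hY
  exact (((contMDiffAt_fderiv_chart hφ).mdifferentiableAt (by simp)).clm_apply
    hY').congr_of_eventuallyEq (eventually_diff_eq hφ Y)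

/-- A vector field is differentiable as soon as its image under an immersion is. In the chart at
`x`, the components of the field are obtained from its image by a smooth family of left
inverses of the differential: with `L` a left inverse of the matrix `P x`, these are
`(L P)⁻¹ L`. -/
theorem VField.DiffAt.of_diff_apply [FiniteDimensional ℝ V] {φ : S → V} {x : S}
    (hφ : ContMDiffAt (𝓡 2) 𝓘(ℝ, V) ∞ φ x) (hinj : Function.Injective (diff φ x))
    {Y : VField S} (hY : MDifferentiableAt (𝓡 2) 𝓘(ℝ, V) (fun y ↦ diff φ y (Y y)) x) :
    Y.DiffAt x := by
  set P : S → Plane →L[ℝ] V := fun y ↦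
    fderiv ℝ (φ ∘ (extChartAt (𝓡 2) x).symm) (extChartAt (𝓡 2) x y) with hP
  have hPs : ContMDiffAt (𝓡 2) 𝓘(ℝ, Plane →L[ℝ] V) ∞ P x := contMDiffAt_fderiv_chart hφ
  have hPinj : Function.Injective (P x) := by
    intro a b hab
    have hs := mem_extChartAt_source (I := 𝓡 2) x
    have hinv := isInvertible_mfderiv_extChartAt (I := 𝓡 2) hs
    obtain ⟨e, he⟩ := hinv
    have key : ∀ c, P x c = diff φ x (e.symm c) := by
      intro c
      rw [diff_eq_fderiv_chart hs (hφ.mdifferentiableAt (by simp)), ← he]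
      exact congrArg (P x) (e.apply_symm_apply c).symm
    rw [key, key] at hab
    exact e.symm.injective (hinj hab)
  obtain ⟨L0, hL0⟩ := (P x).toLinearMap.exists_leftInverse_of_injective
    (LinearMap.ker_eq_bot.2 hPinj)
  let L : V →L[ℝ] Plane := LinearMap.toContinuousLinearMap L0
  let M : S → Plane →L[ℝ] Plane := fun y ↦ L ∘L P y
  have hMx : M x = 1 := by
    ext1 v
    exact DFunLike.congr_fun hL0 v
  have hMs : MDifferentiableAt (𝓡 2) 𝓘(ℝ, Plane →L[ℝ] Plane) M x :=
    (mdifferentiableAt_const (c := L)).clm_comp (hPs.mdifferentiableAt (by simp))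
  have hinv : MDifferentiableAt (𝓡 2) 𝓘(ℝ, Plane →L[ℝ] Plane) (fun y ↦ Ring.inverse (M y)) x := by
    have h1 : DifferentiableAt ℝ (Ring.inverse : (Plane →L[ℝ] Plane) → _) (M x) := by
      rw [hMx]
      exact (contDiffAt_ringInverse ℝ (n := 1) (1 : (Plane →L[ℝ] Plane)ˣ)).differentiableAt
        (by simp)
    exact h1.mdifferentiableAt.comp x hMs
  have hunit : ∀ᶠ y in 𝓝 x, IsUnit (M y) := by
    refine hMs.continuousAt.eventually_mem (Units.isOpen.mem_nhds ?_)
    change IsUnit (M x)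
    rw [hMx]
    exact isUnit_one
  refine (mdifferentiableAt_section _ Y).2 ?_
  refine (hinv.clm_apply ((mdifferentiableAt_const (c := L)).clm_apply
    hY)).congr_of_eventuallyEq ?_
  filter_upwards [eventually_diff_eq hφ Y, hunit] with y h1 h2
  rw [h1]
  exact (DFunLike.congr_fun (Ring.inverse_mul_cancel _ h2) _).symm

/-- The differential of a function on vector fields: `X(dφ(Y)) - Y(dφ(X)) = dφ([X, Y])`. -/
theorem diff_mlieBracket {φ : S → V} {x : S} (hφ : ContMDiffAt (𝓡 2) 𝓘(ℝ, V) ∞ φ x)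
    {X Y : VField S} (hX : X.DiffAt x) (hY : Y.DiffAt x) :
    diff φ x (mlieBracket (𝓡 2) X Y x) =
      diff (fun y ↦ diff φ y (Y y)) x (X x) - diff (fun y ↦ diff φ y (X y)) x (Y x) := by
  set e := extChartAt (𝓡 2) x with he
  have hs : x ∈ e.source := mem_extChartAt_source x
  let pull (Z : VField S) : Plane → Plane :=
    mpullbackWithin 𝓘(ℝ, Plane) (𝓡 2) e.symm Z (Set.range (𝓡 2))
  have hpull : ∀ Z : VField S, Z.DiffAt x → DifferentiableAt ℝ (pull Z) (e x) := by
    intro Z hZ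
    have h := (hZ.mdifferentiableWithinAt
      (s := Set.univ)).differentiableWithinAt_mpullbackWithin_vectorField
    exact h.differentiableAt (by simp)
  have hpull_apply : ∀ (Z : VField S), ∀ y ∈ e.source,
      pull Z (e y) = mfderiv (𝓡 2) 𝓘(ℝ, Plane) e y (Z y) := by
    intro Z y hy
    have h1 := mfderivWithin_extChartAt_symm_comp_mfderiv_extChartAt' (I := 𝓡 2) hy
    have h2 := mfderiv_extChartAt_comp_mfderivWithin_extChartAt_symm' (I := 𝓡 2) hy
    have h3 : (mfderivWithin 𝓘(ℝ, Plane) (𝓡 2) e.symm (Set.range (𝓡 2)) (e y)).inverse =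
        mfderiv (𝓡 2) 𝓘(ℝ, Plane) e y := ContinuousLinearMap.inverse_eq h1 h2
    change (mfderivWithin 𝓘(ℝ, Plane) (𝓡 2) e.symm (Set.range (𝓡 2)) (e y)).inverse
      (Z (e.symm (e y))) = _
    rw [h3]
    have h4 : ∀ y', y' = y → (Z y' : Plane) = Z y := by
      rintro _ rfl
      rfl
    exact congrArg (mfderiv (𝓡 2) 𝓘(ℝ, Plane) e y) (h4 _ (e.left_inv hy))
  set w : Plane → V := φ ∘ e.symm with hw
  have hrepr : ∀ Z : VField S,
      (fun y ↦ diff φ y (Z y)) ∘ e.symm =ᶠ[𝓝 (e x)] fun z ↦ fderiv ℝ w z (pull Z z) := by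
    intro Z
    have h1 : ∀ᶠ y in 𝓝 (e.symm (e x)), MDifferentiableAt (𝓡 2) 𝓘(ℝ, V) φ y := by
      rw [e.left_inv hs]
      exact hφ.eventually_mdifferentiableAt
    have h2 := (continuousAt_extChartAt_symm (I := 𝓡 2) x).eventually h1
    filter_upwards [h2, extChartAt_target_mem_nhds (I := 𝓡 2) x] with z hz hzt
    have hz' := hpull_apply Z (e.symm z) (e.map_target hzt)
    have hz'' := diff_eq_fderiv_chart (e.map_target hzt) hz (Z (e.symm z))
    rw [← he, ← hz', e.right_inv hzt] at hz''
    exact hz''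
  have hderiv : ∀ Z : VField S, Z.DiffAt x → ∀ Z' : VField S,
      diff (fun y ↦ diff φ y (Z y)) x (Z' x) =
        fderiv ℝ (fun z ↦ fderiv ℝ w z (pull Z z)) (e x) (pull Z' (e x)) := by
    intro Z hZ Z'
    rw [diff_eq_fderiv_chart hs (hZ.diff_apply hφ), (hrepr Z).fderiv_eq, hpull_apply Z' x hs]
  rw [hderiv Y hY, hderiv X hX, diff_eq_fderiv_chart hs (hφ.mdifferentiableAt (by simp))]
  have hbr : mfderiv (𝓡 2) 𝓘(ℝ, Plane) e x (mlieBracket (𝓡 2) X Y x) =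
      lieBracket ℝ (pull X) (pull Y) (e x) := by
    obtain ⟨a, ha⟩ := isInvertible_mfderiv_extChartAt (I := 𝓡 2) hs
    have h1 := mlieBracketWithin_apply (I := 𝓡 2) (V := X) (W := Y) (s := Set.univ) (x₀ := x)
    rw [mlieBracketWithin_univ] at h1
    rw [h1, ← he, ← ha, ContinuousLinearMap.inverse_equiv]
    simp only [Set.preimage_univ, Set.univ_inter]
    refine (a.apply_symm_apply _).trans ?_
    change lieBracketWithin ℝ (pull X) (pull Y) (Set.range (𝓡 2)) (e x) = _
    rw [ModelWithCorners.range_eq_univ, lieBracketWithin_univ]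
  rw [← he, hbr]
  have hws : ContDiffAt ℝ ∞ w (e x) := by
    have := (contMDiffAt_iff.1 hφ).2
    rw [ModelWithCorners.range_eq_univ, contDiffWithinAt_univ] at this
    exact this
  exact fderiv_apply_lieBracket hws
    (by rw [minSmoothness_of_isRCLikeNormedField]; exact WithTop.coe_le_coe.2 le_top) (hpull Y hY) (hpull X hX)

end Calculus

/-! ### The Lorentzian scalar product -/

section Lorentz

theorem lorentz_comm (v w : MinkowskiSpace) : lorentz v w = lorentz w v := by
  simp only [lorentz]; ring

theorem lorentz_add_left (v w z : MinkowskiSpace) :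
    lorentz (v + w) z = lorentz v z + lorentz w z := by
  simp only [lorentz, Pi.add_apply]; ring

theorem lorentz_sub_left (v w z : MinkowskiSpace) :
    lorentz (v - w) z = lorentz v z - lorentz w z := by
  simp only [lorentz, Pi.sub_apply]; ring

theorem lorentz_smul_left (c : ℝ) (v z : MinkowskiSpace) :
    lorentz (c • v) z = c * lorentz v z := by
  simp only [lorentz, Pi.smul_apply, smul_eq_mul]; ring

theorem lorentz_neg_right (z v : MinkowskiSpace) : lorentz z (-v) = -lorentz z v := by
  simp only [lorentz, Pi.neg_apply]; ring

/-- The orthogonal complement of a point of hyperbolic space is spacelike. -/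
theorem lorentz_self_pos_of_orthogonal {p v : MinkowskiSpace} (hp : lorentz p p = -1)
    (hvp : lorentz v p = 0) (hv : v ≠ 0) : 0 < lorentz v v := by
  simp only [lorentz] at *
  have hp0 : 0 < p 0 ^ 2 := by nlinarith [sq_nonneg (p 1), sq_nonneg (p 2), sq_nonneg (p 3)]
  -- Lagrange's identity for the spatial parts of `v` and `p`
  have key : (-(v 0 * v 0) + v 1 * v 1 + v 2 * v 2 + v 3 * v 3) * p 0 ^ 2 =
      v 1 ^ 2 + v 2 ^ 2 + v 3 ^ 2 + (v 1 * p 2 - v 2 * p 1) ^ 2 + (v 1 * p 3 - v 3 * p 1) ^ 2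
        + (v 2 * p 3 - v 3 * p 2) ^ 2 := by
    linear_combination (-(v 1 ^ 2 + v 2 ^ 2 + v 3 ^ 2)) * hp
      + (v 0 * p 0 + v 1 * p 1 + v 2 * p 2 + v 3 * p 3) * hvp
  by_contra hneg
  have hle := mul_nonpos_of_nonpos_of_nonneg (not_lt.1 hneg) hp0.le
  rw [key] at hle
  have h1 : v 1 = 0 := by
    apply pow_eq_zero_iff (two_ne_zero) |>.1
    nlinarith [sq_nonneg (v 1), sq_nonneg (v 2), sq_nonneg (v 3),
      sq_nonneg (v 1 * p 2 - v 2 * p 1), sq_nonneg (v 1 * p 3 - v 3 * p 1),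
      sq_nonneg (v 2 * p 3 - v 3 * p 2)]
  have h2 : v 2 = 0 := by
    apply pow_eq_zero_iff (two_ne_zero) |>.1
    nlinarith [sq_nonneg (v 1), sq_nonneg (v 2), sq_nonneg (v 3),
      sq_nonneg (v 1 * p 2 - v 2 * p 1), sq_nonneg (v 1 * p 3 - v 3 * p 1),
      sq_nonneg (v 2 * p 3 - v 3 * p 2)]
  have h3 : v 3 = 0 := by
    apply pow_eq_zero_iff (two_ne_zero) |>.1
    nlinarith [sq_nonneg (v 1), sq_nonneg (v 2), sq_nonneg (v 3),
      sq_nonneg (v 1 * p 2 - v 2 * p 1), sq_nonneg (v 1 * p 3 - v 3 * p 1),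
      sq_nonneg (v 2 * p 3 - v 3 * p 2)]
  have h0 : v 0 = 0 := by
    have : v 0 * p 0 = 0 := by rw [h1, h2, h3] at hvp; linarith
    exact (mul_eq_zero.1 this).resolve_right (by rintro h; simp [h] at hp0)
  exact hv (by ext i; fin_cases i <;> assumption)

variable {S : Type*} [TopologicalSpace S] [ChartedSpace Plane S]

theorem ContMDiffWithinAt.lorentz {V W : S → MinkowskiSpace} {s : Set S} {x : S}
    (hV : ContMDiffWithinAt (𝓡 2) 𝓘(ℝ, MinkowskiSpace) ∞ V s x)
    (hW : ContMDiffWithinAt (𝓡 2) 𝓘(ℝ, MinkowskiSpace) ∞ W s x) :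
    ContMDiffWithinAt (𝓡 2) 𝓘(ℝ, ℝ) ∞ (fun y ↦ lorentz (V y) (W y)) s x := by
  have hc : ∀ {V : S → MinkowskiSpace}, ContMDiffWithinAt (𝓡 2) 𝓘(ℝ, MinkowskiSpace) ∞ V s x →
      ∀ i, ContMDiffWithinAt (𝓡 2) 𝓘(ℝ, ℝ) ∞ (fun y ↦ V y i) s x := fun hV i ↦
    (ContinuousLinearMap.proj (R := ℝ) (φ := fun _ : Fin 4 ↦ ℝ)
      i).contMDiff.contMDiffAt.comp_contMDiffWithinAt x hV
  have hm := fun i ↦ (hc hV i).mul (hc hW i)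
  exact (((hm 0).neg.add (hm 1)).add (hm 2)).add (hm 3)

theorem MDifferentiableAt.lorentz {V W : S → MinkowskiSpace} {x : S}
    (hV : MDifferentiableAt (𝓡 2) 𝓘(ℝ, MinkowskiSpace) V x)
    (hW : MDifferentiableAt (𝓡 2) 𝓘(ℝ, MinkowskiSpace) W x) :
    MDifferentiableAt (𝓡 2) 𝓘(ℝ, ℝ) (fun y ↦ lorentz (V y) (W y)) x := by
  have hc : ∀ {V : S → MinkowskiSpace}, MDifferentiableAt (𝓡 2) 𝓘(ℝ, MinkowskiSpace) V x →
      ∀ i, MDifferentiableAt (𝓡 2) 𝓘(ℝ, ℝ) (fun y ↦ V y i) x := fun hV i ↦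
    (ContinuousLinearMap.proj (R := ℝ) (φ := fun _ : Fin 4 ↦ ℝ)
      i).mdifferentiableAt.comp x hV
  have hm := fun i ↦ (hc hV i).mul (hc hW i)
  exact (((hm 0).neg.add (hm 1)).add (hm 2)).add (hm 3)

end Lorentz

/-! ### Tangent planes and parallel maps -/

namespace ImmersedSurface

open Filter Topology

variable {S : Type*} [TopologicalSpace S] [ChartedSpace Plane S] (F : ImmersedSurface S)

theorem mdifferentiableAt_f (x : S) : MDifferentiableAt (𝓡 2) 𝓘(ℝ, MinkowskiSpace) F.f x :=
  F.f_smooth.mdifferentiableAt (by simp)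

theorem mdifferentiableAt_normal (x : S) :
    MDifferentiableAt (𝓡 2) 𝓘(ℝ, MinkowskiSpace) F.normal x :=
  F.normal_smooth.mdifferentiableAt (by simp)

theorem lorentz_diff_f_f (x : S) (u : Tan x) : lorentz (diff F.f x u) (F.f x) = 0 := by
  have h := diff_lorentz (F.mdifferentiableAt_f x) (F.mdifferentiableAt_f x) u
  simp only [fun y ↦ (F.f_mem y).1, mvfderiv_const, lorentz_comm (F.f x),
    zero_apply] at h
  linarith

theorem lorentz_diff_f_normal (x : S) (u : Tan x) :
    lorentz (diff F.f x u) (F.normal x) = 0 := by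
  rw [lorentz_comm, F.normal_orthogonal]

theorem lorentz_normal_f (x : S) : lorentz (F.normal x) (F.f x) = 0 := F.normal_tangent x

/-- The vectors orthogonal to both the position and the normal are tangent to the surface. -/
theorem exists_diff_f_eq {x : S} {v : MinkowskiSpace} (hf : lorentz v (F.f x) = 0)
    (hn : lorentz v (F.normal x) = 0) : ∃ u, diff F.f x u = v := by
  let L : MinkowskiSpace →ₗ[ℝ] ℝ × ℝ :=
    { toFun := fun v ↦ (lorentz v (F.f x), lorentz v (F.normal x))
      map_add' := fun v w ↦ by simp only [lorentz_add_left, Prod.mk_add_mk]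
      map_smul' := fun c w ↦ by
        simp only [lorentz_smul_left, RingHom.id_apply, Prod.smul_mk, smul_eq_mul] }
  have hL : ∀ v, L v = (lorentz v (F.f x), lorentz v (F.normal x)) := fun _ ↦ rfl
  have hsurj : Function.Surjective L := by
    rintro ⟨a, b⟩
    refine ⟨(-a) • F.f x + b • F.normal x, ?_⟩
    rw [map_add, map_smul, map_smul, hL, hL, (F.f_mem x).1, F.lorentz_normal_f, F.normal_unit,
      lorentz_comm (F.f x), F.lorentz_normal_f]
    ext <;> simp
  have hker : Module.finrank ℝ (LinearMap.ker L) = 2 := by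
    have h := L.finrank_range_add_finrank_ker
    rw [LinearMap.range_eq_top.2 hsurj, finrank_top] at h
    simp at h
    omega
  have hle : LinearMap.range (diff F.f x).toLinearMap ≤ LinearMap.ker L := by
    rintro _ ⟨u, rfl⟩
    rw [LinearMap.mem_ker, hL]
    exact Prod.ext (F.lorentz_diff_f_f x u) (F.lorentz_diff_f_normal x u)
  have hr : Module.finrank ℝ (LinearMap.range (diff F.f x).toLinearMap) = 2 := by
    rw [LinearMap.finrank_range_of_inj (F.f_immersion x)]
    exact (finrank_euclideanSpace_fin : Module.finrank ℝ Plane = 2)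
  have hmem : v ∈ LinearMap.range (diff F.f x).toLinearMap := by
    rw [Submodule.eq_of_le_of_finrank_eq hle (hr.trans hker.symm), LinearMap.mem_ker, hL, hf, hn]
    rfl
  exact hmem

/-- The orthogonal projection of `ℝ⁴` to the tangent plane `df(T_x S)` of the surface. -/
def tanProj (x : S) : MinkowskiSpace →ₗ[ℝ] MinkowskiSpace where
  toFun v := v + lorentz v (F.f x) • F.f x - lorentz v (F.normal x) • F.normal x
  map_add' v w := by simp only [lorentz_add_left]; module
  map_smul' c v := by simp only [lorentz_smul_left, RingHom.id_apply]; module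

theorem tanProj_apply (x : S) (v : MinkowskiSpace) :
    F.tanProj x v = v + lorentz v (F.f x) • F.f x - lorentz v (F.normal x) • F.normal x := rfl

theorem tanProj_f (x : S) : F.tanProj x (F.f x) = 0 := by
  rw [tanProj_apply, (F.f_mem x).1, lorentz_comm, F.lorentz_normal_f]; module

theorem tanProj_normal (x : S) : F.tanProj x (F.normal x) = 0 := by
  rw [tanProj_apply, F.normal_unit, F.lorentz_normal_f]; module

theorem tanProj_diff_f (x : S) (u : Tan x) : F.tanProj x (diff F.f x u) = diff F.f x u := by
  rw [tanProj_apply, F.lorentz_diff_f_f, F.lorentz_diff_f_normal]; module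

theorem lorentz_tanProj_diff_f (x : S) (v : MinkowskiSpace) (u : Tan x) :
    lorentz (F.tanProj x v) (diff F.f x u) = lorentz v (diff F.f x u) := by
  rw [tanProj_apply, lorentz_sub_left, lorentz_add_left, lorentz_smul_left, lorentz_smul_left,
    lorentz_comm (F.f x), lorentz_comm (F.normal x), F.lorentz_diff_f_f,
    F.lorentz_diff_f_normal]
  ring

theorem exists_diff_f_eq_tanProj (x : S) (v : MinkowskiSpace) :
    ∃ u, diff F.f x u = F.tanProj x v := by
  apply F.exists_diff_f_eq <;> rw [tanProj_apply, lorentz_sub_left, lorentz_add_left,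
    lorentz_smul_left, lorentz_smul_left]
  · rw [(F.f_mem x).1, F.lorentz_normal_f]; ring
  · rw [F.normal_unit, lorentz_comm (F.f x), F.lorentz_normal_f]; ring

/-- Weingarten's equation. The projection to the tangent space of `H³` in the definition of `B`
plays no role, since the derivative of the normal is orthogonal to the position vector. -/
theorem diff_normal (x : S) (u : Tan x) : diff F.normal x u = -diff F.f x (F.B x u) := by
  have h := diff_lorentz (F.mdifferentiableAt_normal x) (F.mdifferentiableAt_f x) u
  simp only [F.lorentz_normal_f, mvfderiv_const, zero_apply, F.normal_orthogonal] at h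
  have h' : lorentz (diff F.normal x u) (F.f x) = 0 := by linarith
  have e : F.ambientDeriv F.normal x u
      = diff F.normal x u + lorentz (diff F.normal x u) (F.f x) • F.f x := rfl
  rw [F.diff_f_B, e, h']
  simp

/-- The map `φ : S → ℝ⁴` is smooth and at each point its tangent space is contained in that of
the surface; the endomorphism `C` of `TS` with `dφ = df ∘ C` relates the two. -/
structure IsParallel (φ : S → MinkowskiSpace) (C : (x : S) → Tan x →L[ℝ] Tan x) : Prop where
  smooth : ContMDiff (𝓡 2) 𝓘(ℝ, MinkowskiSpace) ∞ φ
  diff_eq : ∀ x (u : Tan x), diff φ x u = diff F.f x (C x u)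

theorem isParallel_f : F.IsParallel F.f (fun _ ↦ 1) :=
  ⟨F.f_smooth, fun _ _ ↦ rfl⟩

theorem isParallel_sub_normal : F.IsParallel (fun x ↦ F.f x - F.normal x) F.EaddB where
  smooth := F.f_smooth.sub F.normal_smooth
  diff_eq x u := by
    have h := DFunLike.congr_fun
      (mvfderiv_fun_sub (F.mdifferentiableAt_f x) (F.mdifferentiableAt_normal x)) u
    refine h.trans ?_
    change diff F.f x u - diff F.normal x u = diff F.f x (u + F.B x u)
    rw [F.diff_normal, map_add, sub_neg_eq_add]

theorem isParallel_add_normal : F.IsParallel (fun x ↦ F.f x + F.normal x) F.EsubB where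
  smooth := F.f_smooth.add F.normal_smooth
  diff_eq x u := by
    have h := DFunLike.congr_fun
      (mvfderiv_fun_add (F.mdifferentiableAt_f x) (F.mdifferentiableAt_normal x)) u
    refine h.trans ?_
    change diff F.f x u + diff F.normal x u = diff F.f x (u - F.B x u)
    rw [F.diff_normal, map_sub, sub_eq_add_neg]

namespace IsParallel

variable {F} {φ : S → MinkowskiSpace} {C : (x : S) → Tan x →L[ℝ] Tan x}

theorem tanProj_diff (h : F.IsParallel φ C) (x : S) (u : Tan x) :
    F.tanProj x (diff φ x u) = diff φ x u := by
  rw [h.diff_eq, F.tanProj_diff_f]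

theorem lorentz_diff_f (h : F.IsParallel φ C) (x : S) (u : Tan x) :
    lorentz (diff φ x u) (F.f x) = 0 := by
  rw [h.diff_eq, F.lorentz_diff_f_f]

theorem lorentz_diff_normal (h : F.IsParallel φ C) (x : S) (u : Tan x) :
    lorentz (diff φ x u) (F.normal x) = 0 := by
  rw [h.diff_eq, F.lorentz_diff_f_normal]

theorem lorentz_tanProj_diff (h : F.IsParallel φ C) (x : S) (v : MinkowskiSpace) (u : Tan x) :
    lorentz (F.tanProj x v) (diff φ x u) = lorentz v (diff φ x u) := by
  rw [h.diff_eq, F.lorentz_tanProj_diff_f]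

theorem diff_injective (h : F.IsParallel φ C) {x : S} (hC : IsUnit (C x)) :
    Function.Injective (diff φ x) := by
  intro u v huv
  rw [h.diff_eq, h.diff_eq] at huv
  have h2 : C x u = C x v := F.f_immersion x huv
  have h3 : ∀ w, Ring.inverse (C x) (C x w) = w := fun w ↦
    DFunLike.congr_fun (Ring.inverse_mul_cancel _ hC) w
  rw [← h3 u, h2, h3]

theorem lorentz_diff_self_pos (h : F.IsParallel φ C) {x : S} (hC : IsUnit (C x)) {u : Tan x}
    (hu : u ≠ 0) : 0 < lorentz (diff φ x u) (diff φ x u) :=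
  lorentz_self_pos_of_orthogonal (F.f_mem x).1 (h.lorentz_diff_f x u)
    (fun h0 ↦ hu (h.diff_injective hC (h0.trans (map_zero _).symm)))

end IsParallel

end ImmersedSurface

/-! ### Uniqueness of the Levi-Civita connection -/

section Uniqueness

variable {S : Type*} [TopologicalSpace S] [ChartedSpace Plane S] [IsManifold (𝓡 2) ∞ S]

/-- Uniqueness of the Levi-Civita connection of a definite metric: the difference of two of them
is a tensor which is symmetric in its first two arguments and skew in its last two. -/
theorem IsLeviCivita.eq_of_pos {g : FormField S} (hsymm : ∀ x (u v : Tan x), g x u v = g x v u)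
    (hpos : ∀ x (u : Tan x), u ≠ 0 → 0 < g x u u) {nabla nabla' : ConnOperator S}
    (h : IsLeviCivita g nabla) (h' : IsLeviCivita g nabla') {Y : VField S} {x : S}
    (hY : Y.DiffAt x) : nabla Y x = nabla' Y x := by
  set D := h.connection.difference h'.connection x with hD
  have hDapp : ∀ Z : VField S, Z.DiffAt x → D (Z x) = nabla Z x - nabla' Z x := fun Z hZ ↦
    h.connection.difference_apply h'.connection (by trivial) hZ
  have hext : ∀ u : Tan x, ∃ Z : VField S, Z.DiffAt x ∧ Z x = u := fun u ↦
    ⟨FiberBundle.extend Plane u, FiberBundle.mdifferentiableAt_extend (𝓡 2) Plane u,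
      FiberBundle.extend_apply_self Plane u⟩
  have hDsymm : ∀ u v, D u v = D v u := by
    intro u v
    obtain ⟨U, hU, rfl⟩ := hext u
    obtain ⟨W, hW, rfl⟩ := hext v
    have e := (h.torsion_free U W x hU hW).trans (h'.torsion_free U W x hU hW).symm
    rw [hDapp U hU, hDapp W hW]
    change nabla U x (W x) - nabla' U x (W x) = nabla W x (U x) - nabla' W x (U x)
    rw [sub_eq_sub_iff_add_eq_add] at e ⊢
    rw [add_comm, ← e]
  have hDskew : ∀ u v w, g x (D u w) v + g x u (D v w) = 0 := by
    intro u v w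
    obtain ⟨U, hU, rfl⟩ := hext u
    obtain ⟨W, hW, rfl⟩ := hext v
    have e := (h.metric U W x hU hW w).symm.trans (h'.metric U W x hU hW w)
    rw [hDapp U hU, hDapp W hW]
    change g x (nabla U x w - nabla' U x w) (W x) + g x (U x) (nabla W x w - nabla' W x w) = 0
    rw [map_sub, map_sub, LinearMap.sub_apply]
    linarith
  have hzero : ∀ u v, D u v = 0 := by
    intro u v
    by_contra hne
    have hp := hpos x _ hne
    -- `g (D a b) c` changes sign under cyclic permutations of `a`, `b`, `c`
    have key : ∀ a b c, g x (D a b) c = 0 := by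
      intro a b c
      have e1 := hDskew a c b
      have e2 := hDskew c b a
      have e3 := hDskew b a c
      rw [hsymm x a] at e1
      rw [hsymm x c] at e2
      rw [hsymm x b] at e3
      rw [hDsymm c b] at e1
      rw [hDsymm c a, hDsymm b a] at e2
      linarith
    exact hp.ne' (key _ _ _)
  have e := hDapp Y hY
  ext1 u
  have e' := DFunLike.congr_fun e u
  rw [hzero] at e'
  exact (sub_eq_zero.1 e'.symm)

end Uniqueness

/-! ### Connections induced by parallel maps -/

namespace ImmersedSurface

open Filter Topology VectorField

variable {S : Type*} [TopologicalSpace S] [ChartedSpace Plane S] [IsManifold (𝓡 2) ∞ S]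
  (F : ImmersedSurface S)

/-- The connection `nabla` is induced by `φ : S → ℝ⁴`: the vector `dφ(∇_u Y)` is the projection to
the tangent plane of the surface of the derivative of `dφ(Y)` in the direction `u`. -/
def IsInducedConn (φ : S → MinkowskiSpace) (nabla : ConnOperator S) : Prop :=
  ∀ (Y : VField S) (x : S), Y.DiffAt x → ∀ u : Tan x,
    diff φ x (nabla Y x u) = F.tanProj x (diff (fun y ↦ diff φ y (Y y)) x u)

theorem exists_isInducedConn_f : ∃ nabla : ConnOperator S, F.IsInducedConn F.f nabla := by
  refine ⟨fun Y x ↦ LinearMap.toContinuousLinearMap ((diff F.f x).toLinearMap.leftInverse ∘ₗ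
    F.tanProj x ∘ₗ (diff (fun y ↦ diff F.f y (Y y)) x).toLinearMap), ?_⟩
  intro Y x _ u
  obtain ⟨w, hw⟩ := F.exists_diff_f_eq_tanProj x (diff (fun y ↦ diff F.f y (Y y)) x u)
  change diff F.f x ((diff F.f x).toLinearMap.leftInverse
    (F.tanProj x (diff (fun y ↦ diff F.f y (Y y)) x u))) = _
  rw [← hw]
  congr 1
  exact LinearMap.leftInverse_apply_of_inj (LinearMap.ker_eq_bot.2 (F.f_immersion x)) w

variable {F} {φ : S → MinkowskiSpace} {C : (x : S) → Tan x →L[ℝ] Tan x}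
  {nabla : ConnOperator S}

/-- Torsion-freeness and Codazzi's equation both come from this identity, applied respectively to
the map inducing the connection and to another parallel map. -/
theorem IsParallel.tanProj_diff_mlieBracket {ψ : S → MinkowskiSpace}
    {D : (x : S) → Tan x →L[ℝ] Tan x} (hψ : F.IsParallel ψ D) {X Y : VField S} {x : S}
    (hX : X.DiffAt x) (hY : Y.DiffAt x) :
    F.tanProj x (diff (fun y ↦ diff ψ y (Y y)) x (X x))
      - F.tanProj x (diff (fun y ↦ diff ψ y (X y)) x (Y x)) =
      diff ψ x (mlieBracket (𝓡 2) X Y x) := by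
  rw [← map_sub, ← diff_mlieBracket hψ.smooth.contMDiffAt hX hY, hψ.tanProj_diff]

theorem IsInducedConn.isLeviCivita (h : F.IsInducedConn φ nabla) (hφ : F.IsParallel φ C)
    (hC : ∀ x, IsUnit (C x)) {c : ℝ} {g : FormField S}
    (hg : ∀ x u v, g x u v = c * lorentz (diff φ x u) (diff φ x v)) : IsLeviCivita g nabla where
  connection :=
    { add := by
        intro Y Z x hY hZ _
        have hY' := VField.DiffAt.diff_apply hφ.smooth.contMDiffAt hY
        have hZ' := VField.DiffAt.diff_apply hφ.smooth.contMDiffAt hZ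
        have hs : VField.DiffAt (Y + Z) x := mdifferentiableAt_add_section hY hZ
        ext1 u
        apply hφ.diff_injective (hC x)
        have e : (fun y ↦ diff φ y ((Y + Z) y)) =
            fun y ↦ diff φ y (Y y) + diff φ y (Z y) := by
          ext1 y
          exact map_add _ _ _
        have e' := DFunLike.congr_fun (mvfderiv_fun_add hY' hZ') u
        change _ = diff φ x (nabla Y x u + nabla Z x u)
        rw [map_add, h _ _ hs, h _ _ hY, h _ _ hZ, ← map_add, e]
        exact congrArg _ e'
      leibniz := by
        intro Y a x hY ha _
        have hY' := VField.DiffAt.diff_apply hφ.smooth.contMDiffAt hY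
        have hs : VField.DiffAt (a • Y) x := ha.smul_section hY
        ext1 u
        apply hφ.diff_injective (hC x)
        have e : (fun y ↦ diff φ y ((a • Y) y)) = fun y ↦ a y • diff φ y (Y y) := by
          ext1 y
          exact (diff φ y).map_smul _ _
        have e' := DFunLike.congr_fun (mvfderiv_fun_smul ha hY') u
        change _ = diff φ x (a x • nabla Y x u + diff a x u • Y x)
        rw [(diff φ x).map_add, (diff φ x).map_smul, (diff φ x).map_smul, h _ _ hs, h _ _ hY, e,
          ← hφ.tanProj_diff x (Y x), ← (F.tanProj x).map_smul, ← (F.tanProj x).map_smul,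
          ← (F.tanProj x).map_add]
        exact congrArg _ e' }
  metric := by
    intro Y Z x hY hZ u
    have hY' := VField.DiffAt.diff_apply hφ.smooth.contMDiffAt hY
    have hZ' := VField.DiffAt.diff_apply hφ.smooth.contMDiffAt hZ
    have e : (fun y ↦ g y (Y y) (Z y)) =
        fun y ↦ c * lorentz (diff φ y (Y y)) (diff φ y (Z y)) := by
      ext1 y
      exact hg _ _ _
    have e' := DFunLike.congr_fun
      (mvfderiv_fun_mul (mdifferentiableAt_const (c := c)) (hY'.lorentz hZ')) u
    rw [e, hg, hg, h _ _ hY, h _ _ hZ, hφ.lorentz_tanProj_diff,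
      lorentz_comm (diff φ x (Y x)), hφ.lorentz_tanProj_diff, ← mul_add,
      lorentz_comm _ (diff φ x (Y x)), ← diff_lorentz hY' hZ' u]
    rw [mvfderiv_const, smul_zero, add_zero] at e'
    exact e'
  torsion_free := by
    intro X Y x hX hY
    apply hφ.diff_injective (hC x)
    rw [map_sub, h _ _ hX, h _ _ hY, hφ.tanProj_diff_mlieBracket hX hY]

/-- Every Levi-Civita connection of `c ⟪dφ, dφ⟫` is induced by `φ`, since it agrees on
differentiable fields with any connection induced by `φ`. -/
theorem IsInducedConn.of_isLeviCivita {nabla' : ConnOperator S} (h : F.IsInducedConn φ nabla')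
    (hφ : F.IsParallel φ C) (hC : ∀ x, IsUnit (C x)) {c : ℝ} (hc : 0 < c) {g : FormField S}
    (hg : ∀ x u v, g x u v = c * lorentz (diff φ x u) (diff φ x v))
    (hnabla : IsLeviCivita g nabla) :
    F.IsInducedConn φ nabla ∧ ∀ (Y : VField S) x, Y.DiffAt x → nabla Y x = nabla' Y x := by
  have key : ∀ (Y : VField S) x, Y.DiffAt x → nabla Y x = nabla' Y x := fun Y x hY ↦
    hnabla.eq_of_pos (fun x u v ↦ by rw [hg, hg, lorentz_comm])
      (fun x u hu ↦ by rw [hg]; exact mul_pos hc (hφ.lorentz_diff_self_pos (hC x) hu))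
      (h.isLeviCivita hφ hC hg) hY
  exact ⟨fun Y x hY u ↦ by rw [key Y x hY, h Y x hY], key⟩

/-- If `dφ = df ∘ C`, conjugation by `C` turns the connection induced by `f` into the one induced
by `φ`. -/
theorem IsInducedConn.conjConn (h : F.IsInducedConn F.f nabla) (hφ : F.IsParallel φ C)
    (hC : ∀ x, IsUnit (C x)) : F.IsInducedConn φ (conjConn C nabla) := by
  intro Y x hY u
  have e : (fun y ↦ diff F.f y (C y (Y y))) = fun y ↦ diff φ y (Y y) := by
    ext1 y
    rw [hφ.diff_eq]
  have hY' : MDifferentiableAt (𝓡 2) 𝓘(ℝ, MinkowskiSpace)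
      (fun y ↦ diff F.f y (C y (Y y))) x := by
    rw [e]
    exact VField.DiffAt.diff_apply hφ.smooth.contMDiffAt hY
  have hCY : VField.DiffAt (fun y ↦ C y (Y y)) x :=
    .of_diff_apply F.f_smooth.contMDiffAt (F.f_immersion x) hY'
  have e2 : C x (_root_.conjConn C nabla Y x u) = nabla (fun y ↦ C y (Y y)) x u :=
    DFunLike.congr_fun (Ring.mul_inverse_cancel _ (hC x)) _
  rw [hφ.diff_eq, e2, h _ _ hCY, e]

/-- Codazzi's equation for a field of endomorphisms `A` such that `dφ ∘ A` is a differential. -/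
theorem IsInducedConn.extCovDeriv_eq_zero (h : F.IsInducedConn φ nabla) (hφ : F.IsParallel φ C)
    (hC : ∀ x, IsUnit (C x)) {ψ : S → MinkowskiSpace} {D : (x : S) → Tan x →L[ℝ] Tan x}
    (hψ : F.IsParallel ψ D) {A : (x : S) → Tan x →L[ℝ] Tan x} (hA : ∀ x, C x * A x = D x)
    {X Y : VField S} {x : S} (hX : X.DiffAt x) (hY : Y.DiffAt x) :
    extCovDeriv nabla A X Y x = 0 := by
  have hA' : ∀ y (u : Tan y), diff φ y (A y u) = diff ψ y u := by
    intro y u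
    rw [hφ.diff_eq, hψ.diff_eq, ← hA]
    rfl
  have hAdiff : ∀ Z : VField S, Z.DiffAt x → VField.DiffAt (fun y ↦ A y (Z y)) x := by
    intro Z hZ
    refine .of_diff_apply hφ.smooth.contMDiffAt (hφ.diff_injective (hC x)) ?_
    simp only [hA']
    exact VField.DiffAt.diff_apply hψ.smooth.contMDiffAt hZ
  apply hφ.diff_injective (hC x)
  rw [extCovDeriv, map_sub, map_sub, h _ _ (hAdiff Y hY), h _ _ (hAdiff X hX), hA']
  simp only [hA']
  rw [hψ.tanProj_diff_mlieBracket hX hY, sub_self, map_zero]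

end ImmersedSurface

/-! ### Algebra of endomorphisms of a plane -/

section PlaneAlgebra

variable {E : Type*} [AddCommGroup E] [Module ℝ E] (b : Module.Basis (Fin 2) ℝ E)

theorem linearMap_apply_basis_fin_two (A : E →ₗ[ℝ] E) (j : Fin 2) :
    A (b j) = LinearMap.toMatrix b b A 0 j • b 0 + LinearMap.toMatrix b b A 1 j • b 1 := by
  simp only [LinearMap.toMatrix_apply]
  rw [← Fin.sum_univ_two (f := fun i ↦ b.repr (A (b j)) i • b i), b.sum_repr]

theorem det_eq_toMatrix_fin_two (A : E →ₗ[ℝ] E) :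
    LinearMap.det A = LinearMap.toMatrix b b A 0 0 * LinearMap.toMatrix b b A 1 1
      - LinearMap.toMatrix b b A 0 1 * LinearMap.toMatrix b b A 1 0 := by
  rw [← LinearMap.det_toMatrix b, Matrix.det_fin_two]

theorem trace_eq_toMatrix_fin_two (A : E →ₗ[ℝ] E) :
    LinearMap.trace ℝ E A = LinearMap.toMatrix b b A 0 0 + LinearMap.toMatrix b b A 1 1 := by
  rw [LinearMap.trace_eq_matrix_trace ℝ b, Matrix.trace_fin_two]

/-- The determinant of mutual products of the images of a basis under two endomorphisms. -/
theorem gram_det_eq (q : E →ₗ[ℝ] E →ₗ[ℝ] ℝ) (A C : E →ₗ[ℝ] E) :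
    q (A (b 0)) (C (b 0)) * q (A (b 1)) (C (b 1)) - q (A (b 0)) (C (b 1)) * q (A (b 1)) (C (b 0)) =
      LinearMap.det A * LinearMap.det C *
        (q (b 0) (b 0) * q (b 1) (b 1) - q (b 0) (b 1) * q (b 1) (b 0)) := by
  rw [det_eq_toMatrix_fin_two b A, det_eq_toMatrix_fin_two b C]
  simp only [linearMap_apply_basis_fin_two b, map_add, map_smul, LinearMap.add_apply,
    LinearMap.smul_apply, smul_eq_mul]
  ring

theorem gram_det_ne_zero {q : E →ₗ[ℝ] E →ₗ[ℝ] ℝ} (hsymm : ∀ u v, q u v = q v u)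
    (hpos : ∀ u, u ≠ 0 → 0 < q u u) :
    q (b 0) (b 0) * q (b 1) (b 1) - q (b 0) (b 1) * q (b 1) (b 0) ≠ 0 := by
  intro h
  set w := q (b 0) (b 0) • b 1 - q (b 0) (b 1) • b 0 with hw
  have h0 := hpos (b 0) (b.ne_zero 0)
  have hne : w ≠ 0 := by
    intro hw0
    have := congrArg (fun v ↦ b.repr v 1) hw0
    simp [hw] at this
    exact h0.ne' this
  have hww : q w w = 0 := by
    simp only [hw, map_sub, map_smul, LinearMap.sub_apply, LinearMap.smul_apply, smul_eq_mul]
    rw [hsymm (b 1) (b 0)] at h ⊢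
    linear_combination q (b 0) (b 0) * h
  exact (hpos w hne).ne' hww

/-- The characteristic polynomial of a plane endomorphism at `-1`, up to sign. -/
theorem det_one_add_of_finrank_eq_two [FiniteDimensional ℝ E] (hE : Module.finrank ℝ E = 2)
    (A : E →ₗ[ℝ] E) :
    LinearMap.det (1 + A) = 1 + LinearMap.trace ℝ E A + LinearMap.det A := by
  let b := Module.finBasisOfFinrankEq ℝ E hE
  rw [det_eq_toMatrix_fin_two b, trace_eq_toMatrix_fin_two b, det_eq_toMatrix_fin_two b A,
    map_add, LinearMap.toMatrix_one]
  simp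
  ring

/-- The trace of the Cayley transform `T = (1 + A)⁻¹ (1 - A)` of a plane endomorphism. -/
theorem det_mul_trace_cayley_of_finrank_eq_two [FiniteDimensional ℝ E]
    (hE : Module.finrank ℝ E = 2) {A T : E →ₗ[ℝ] E} (h : (1 + A) * T = 1 - A) :
    LinearMap.det (1 + A) * LinearMap.trace ℝ E T = 2 * (1 - LinearMap.det A) := by
  let b := Module.finBasisOfFinrankEq ℝ E hE
  have h' := congrArg (LinearMap.toMatrix b b) h
  rw [LinearMap.toMatrix_mul, map_add, map_sub, LinearMap.toMatrix_one] at h'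
  rw [det_eq_toMatrix_fin_two b, trace_eq_toMatrix_fin_two b, det_eq_toMatrix_fin_two b A,
    map_add, LinearMap.toMatrix_one]
  have h00 := congrFun (congrFun h' 0) 0
  have h01 := congrFun (congrFun h' 0) 1
  have h10 := congrFun (congrFun h' 1) 0
  have h11 := congrFun (congrFun h' 1) 1
  simp [Matrix.mul_apply, Fin.sum_univ_two] at h00 h01 h10 h11 ⊢
  set M := LinearMap.toMatrix b b A
  linear_combination (1 + M 1 1) * h00 - M 0 1 * h10 + (1 + M 0 0) * h11 - M 1 0 * h01

end PlaneAlgebra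

/-! ### Gauss's equation -/

namespace ImmersedSurface

open Filter Topology VectorField

variable {S : Type*} [TopologicalSpace S] [ChartedSpace Plane S]
  {F : ImmersedSurface S}

theorem det_toLinearMap_ne_zero {x : S} {A : Tan x →L[ℝ] Tan x} (hA : IsUnit A) :
    LinearMap.det A.toLinearMap ≠ 0 := by
  have h : IsUnit A.toLinearMap :=
    hA.map (ContinuousLinearMap.toLinearMapRingHom (R₁ := ℝ) (M₁ := Tan x))
  exact (h.map LinearMap.det).ne_zero

theorem finrank_tan (x : S) : Module.finrank ℝ (Tan x) = 2 :=
  (finrank_euclideanSpace_fin : Module.finrank ℝ Plane = 2)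

theorem det_EaddB (F : ImmersedSurface S) (x : S) :
    LinearMap.det (F.EaddB x).toLinearMap = 1 + F.H x + F.Ke x :=
  det_one_add_of_finrank_eq_two (finrank_tan x) (F.B x).toLinearMap

theorem EaddB_mul_BStar (F : ImmersedSurface S) {x : S} (hx : IsUnit (F.EaddB x)) :
    F.EaddB x * F.BStar x = F.EsubB x := by
  rw [BStar, ← mul_assoc, Ring.mul_inverse_cancel _ hx, one_mul]

theorem det_EaddB_mul_HStar (F : ImmersedSurface S) {x : S} (hx : IsUnit (F.EaddB x)) :
    LinearMap.det (F.EaddB x).toLinearMap * F.HStar x = 2 * (1 - F.Ke x) :=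
  det_mul_trace_cayley_of_finrank_eq_two (finrank_tan x)
    (congrArg ContinuousLinearMap.toLinearMap (F.EaddB_mul_BStar hx))

theorem mdifferentiableAt_tanProj {V : S → MinkowskiSpace} {x : S}
    (hV : MDifferentiableAt (𝓡 2) 𝓘(ℝ, MinkowskiSpace) V x) :
    MDifferentiableAt (𝓡 2) 𝓘(ℝ, MinkowskiSpace) (fun y ↦ F.tanProj y (V y)) x :=
  (hV.add ((hV.lorentz (F.mdifferentiableAt_f x)).smul (F.mdifferentiableAt_f x))).sub
    ((hV.lorentz (F.mdifferentiableAt_normal x)).smul (F.mdifferentiableAt_normal x))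

/-- The tangential derivative of the tangential part of a field `V` along the surface. -/
theorem tanProj_diff_tanProj {V : S → MinkowskiSpace} {x : S}
    (hV : MDifferentiableAt (𝓡 2) 𝓘(ℝ, MinkowskiSpace) V x) (u : Tan x) :
    F.tanProj x (diff (fun y ↦ F.tanProj y (V y)) x u) = F.tanProj x (diff V x u)
      + lorentz (V x) (F.f x) • diff F.f x u
      + lorentz (V x) (F.normal x) • diff F.f x (F.B x u) := by
  have hf := hV.lorentz (F.mdifferentiableAt_f x)
  have hn := hV.lorentz (F.mdifferentiableAt_normal x)
  have hfs := hf.smul (F.mdifferentiableAt_f x)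
  have hns := hn.smul (F.mdifferentiableAt_normal x)
  have e1 := DFunLike.congr_fun (mvfderiv_fun_sub (hV.add hfs) hns) u
  have e2 := DFunLike.congr_fun (mvfderiv_fun_add hV hfs) u
  have e3 := DFunLike.congr_fun (mvfderiv_fun_smul hf (F.mdifferentiableAt_f x)) u
  have e4 := DFunLike.congr_fun (mvfderiv_fun_smul hn (F.mdifferentiableAt_normal x)) u
  have e : diff (fun y ↦ F.tanProj y (V y)) x u = diff V x u
      + (lorentz (V x) (F.f x) • diff F.f x u
        + (diff (fun y ↦ lorentz (V y) (F.f y)) x u) • F.f x)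
      - (lorentz (V x) (F.normal x) • diff F.normal x u
        + (diff (fun y ↦ lorentz (V y) (F.normal y)) x u) • F.normal x) := by
    exact e1.trans (congrArg₂ (· - ·) (e2.trans (congrArg₂ (· + ·) rfl e3)) e4)
  rw [e, F.diff_normal]
  simp only [map_add, map_sub, map_smul, map_neg, smul_neg, tanProj_f, tanProj_normal,
    tanProj_diff_f, smul_zero]
  module

variable [IsManifold (𝓡 2) ∞ S] {φ : S → MinkowskiSpace} {C : (x : S) → Tan x →L[ℝ] Tan x}
  {nabla : ConnOperator S}

/-- Gauss's equation for the connection induced by a parallel map: the curvature is read off from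
the components along the position vector and the normal of the second derivatives, which are
`⟪dφ(Z), df(Y)⟫` and `⟪dφ(Z), df(B Y)⟫`. -/
theorem IsInducedConn.diff_riemannCurvature (h : F.IsInducedConn φ nabla)
    (hφ : F.IsParallel φ C) (hC : ∀ x, IsUnit (C x)) {X Y Z : VField S} {x : S}
    (hX : X.DiffAt x) (hY : Y.DiffAt x) (hZ : ContMDiffAt (𝓡 2) (𝓡 2).tangent ∞
      (fun y ↦ (Bundle.TotalSpace.mk' Plane y (Z y) : TangentBundle (𝓡 2) S)) x) :
    diff φ x (riemannCurvature nabla X Y Z x) =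
      lorentz (diff φ x (Z x)) (diff F.f x (F.B x (Y x))) • diff F.f x (F.B x (X x))
      - lorentz (diff φ x (Z x)) (diff F.f x (F.B x (X x))) • diff F.f x (F.B x (Y x))
      - lorentz (diff φ x (Z x)) (diff F.f x (Y x)) • diff F.f x (X x)
      + lorentz (diff φ x (Z x)) (diff F.f x (X x)) • diff F.f x (Y x) := by
  set W : S → MinkowskiSpace := fun y ↦ diff φ y (Z y) with hWdef
  have hW : ContMDiffAt (𝓡 2) 𝓘(ℝ, MinkowskiSpace) ∞ W x :=
    ContMDiffAt.diff_apply hφ.smooth.contMDiffAt hZ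
  have hZx : Z.DiffAt x := hZ.mdifferentiableAt (by simp)
  have hZev : ∀ᶠ y in 𝓝 x, Z.DiffAt y := by
    have h1 := hZ.of_le (m := 1) (WithTop.coe_le_coe.2 le_top)
    filter_upwards [(contMDiffAt_iff_contMDiffAt_nhds (by simp)).1 h1] with y hy
    exact hy.mdifferentiableAt (by simp)
  have hnabla : ∀ T : VField S, (fun y ↦ diff φ y (nabla Z y (T y))) =ᶠ[𝓝 x]
      fun y ↦ F.tanProj y (diff W y (T y)) := by
    intro T
    filter_upwards [hZev] with y hy using h Z y hy (T y)
  have hdiff : ∀ T : VField S, T.DiffAt x → VField.DiffAt (fun y ↦ nabla Z y (T y)) x := by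
    intro T hT
    refine .of_diff_apply hφ.smooth.contMDiffAt (hφ.diff_injective (hC x)) ?_
    exact (mdifferentiableAt_tanProj (hT.diff_apply hW)).congr_of_eventuallyEq (hnabla T)
  have hf : ∀ u, lorentz (diff W x u) (F.f x) = -lorentz (W x) (diff F.f x u) := by
    intro u
    have e := diff_lorentz (hW.mdifferentiableAt (by simp)) (F.mdifferentiableAt_f x) u
    simp only [hWdef, hφ.lorentz_diff_f, mvfderiv_const, zero_apply] at e
    linarith
  have hn : ∀ u, lorentz (diff W x u) (F.normal x) = lorentz (W x) (diff F.f x (F.B x u)) := by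
    intro u
    have e := diff_lorentz (hW.mdifferentiableAt (by simp)) (F.mdifferentiableAt_normal x) u
    simp only [hWdef, hφ.lorentz_diff_normal, mvfderiv_const, zero_apply, F.diff_normal,
      lorentz_neg_right] at e
    linarith
  have hsecond : ∀ T : VField S, T.DiffAt x → ∀ u,
      diff φ x (nabla (fun y ↦ nabla Z y (T y)) x u) =
        F.tanProj x (diff (fun y ↦ diff W y (T y)) x u)
        - lorentz (W x) (diff F.f x (T x)) • diff F.f x u
        + lorentz (W x) (diff F.f x (F.B x (T x))) • diff F.f x (F.B x u) := by
    intro T hT u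
    rw [h _ _ (hdiff T hT), diff_congr (hnabla T), tanProj_diff_tanProj (hT.diff_apply hW), hf, hn]
    module
  rw [riemannCurvature, map_sub, map_sub, hsecond Y hY, hsecond X hX, h _ _ hZx]
  have hbr := congrArg (F.tanProj x) (diff_mlieBracket hW hX hY)
  rw [map_sub] at hbr
  rw [hbr]
  module

/-- The Gauss curvature of the metric `c ⟪dφ, dφ⟫`. -/
theorem IsInducedConn.gaussCurvature_eq (h : F.IsInducedConn φ nabla)
    (hφ : F.IsParallel φ C) (hC : ∀ x, IsUnit (C x)) {c : ℝ} (hc : 0 < c) {g : FormField S}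
    (hg : ∀ x u v, g x u v = c * lorentz (diff φ x u) (diff φ x v)) (x : S) :
    gaussCurvature g nabla x = (F.Ke x - 1) / (c * LinearMap.det (C x).toLinearMap) := by
  let b : Module.Basis (Fin 2) ℝ (Tan x) := (EuclideanSpace.basisFun (Fin 2) ℝ).toBasis
  have hb : ∀ i, coordField x i x = b i := by
    intro i
    refine (FiberBundle.extend_apply_self Plane _).trans ?_
    exact (EuclideanSpace.basisFun_apply (Fin 2) ℝ i).symm
  have hsmooth : ∀ i, ContMDiffAt (𝓡 2) (𝓡 2).tangent ∞
      (fun y ↦ (Bundle.TotalSpace.mk' Plane y (coordField x i y) : TangentBundle (𝓡 2) S)) x :=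
    fun i ↦ FiberBundle.contMDiffAt_extend (𝓡 2) Plane _
  have hR := h.diff_riemannCurvature hφ hC ((hsmooth 0).mdifferentiableAt (by simp))
    ((hsmooth 1).mdifferentiableAt (by simp)) (hsmooth 1)
  have hI : ∀ u v, lorentz (diff F.f x u) (diff F.f x v) = F.I x u v := fun _ _ ↦ rfl
  have hIsymm : ∀ u v, F.I x u v = F.I x v u := fun u v ↦ lorentz_comm _ _
  have hgram := gram_det_ne_zero b hIsymm (fun u hu ↦
    F.isParallel_f.lorentz_diff_self_pos isUnit_one hu)
  have hdet := det_toLinearMap_ne_zero (hC x)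
  have hBC := gram_det_eq b (F.I x) (F.B x).toLinearMap (C x).toLinearMap
  have h1C := gram_det_eq b (F.I x) 1 (C x).toLinearMap
  have hCC := gram_det_eq b (F.I x) (C x).toLinearMap (C x).toLinearMap
  simp only [gaussCurvature, hg, hR, hb, hφ.diff_eq, lorentz_sub_left, lorentz_add_left,
    lorentz_smul_left, hI]
  simp only [ContinuousLinearMap.coe_coe, Module.End.one_apply, map_one, one_mul] at hBC h1C hCC
  have hcomm : ∀ u v, F.I x (C x u) v = F.I x v (C x u) := fun u v ↦ hIsymm _ _
  rw [hcomm _ (F.B x _), hcomm _ (F.B x _), hcomm _ (b 1), hcomm _ (b 0)]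
  rw [hcomm (b 1) (C x (b 0))] at hCC
  rw [Ke, div_eq_div_iff _ (mul_ne_zero hc.ne' hdet)]
  · linear_combination (c ^ 2 * LinearMap.det (C x).toLinearMap) * (hBC - h1C)
      - (LinearMap.det (F.B x).toLinearMap - 1) * c ^ 2 * hCC
  · intro h0
    refine mul_ne_zero (pow_ne_zero 2 hc.ne') (mul_ne_zero (mul_ne_zero hdet hdet) hgram) ?_
    linear_combination h0 - c ^ 2 * hCC

/-- The metric `c ⟪dφ, dφ⟫` is smooth and definite when `φ` is a parallel immersion. -/
theorem IsParallel.isSmoothMetric (hφ : F.IsParallel φ C) (hC : ∀ x, IsUnit (C x)) {c : ℝ}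
    (hc : 0 < c) {g : FormField S}
    (hg : ∀ x u v, g x u v = c * lorentz (diff φ x u) (diff φ x v)) : IsSmoothMetric g where
  symm x u v := by rw [hg, hg, lorentz_comm]
  pos x u hu := by
    rw [hg]
    exact mul_pos hc (hφ.lorentz_diff_self_pos (hC x) hu)
  smooth U hU Y Z hY hZ y hy := by
    simp only [hg]
    have hmem := hU.mem_nhds hy
    have hY' := ContMDiffAt.diff_apply hφ.smooth.contMDiffAt (hY.contMDiffAt hmem)
    have hZ' := ContMDiffAt.diff_apply hφ.smooth.contMDiffAt (hZ.contMDiffAt hmem)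
    exact contMDiffWithinAt_const.mul
      (hY'.contMDiffWithinAt.lorentz hZ'.contMDiffWithinAt)

end ImmersedSurface

end

/-! ### The metric at infinity -/

theorem mainTheorem12 {S : Type*} [TopologicalSpace S] [T2Space S] [ChartedSpace Plane S]
    [IsManifold (𝓡 2) ∞ S] (F : ImmersedSurface S) (hF : ∀ x, IsUnit (F.EaddB x)) :
    IsSmoothMetric F.IStar ∧
    (∃ nabla : ConnOperator S, IsLeviCivita F.I nabla) ∧
    ∀ nabla : ConnOperator S, IsLeviCivita F.I nabla →
      IsLeviCivita F.IStar (conjConn F.EaddB nabla) ∧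
      ∀ nablaStar : ConnOperator S, IsLeviCivita F.IStar nablaStar →
        (∀ (Y : VField S) (x : S), Y.DiffAt x → nablaStar Y x = conjConn F.EaddB nabla Y x) ∧
        (∀ x, gaussCurvature F.IStar nablaStar x =
          2 * gaussCurvature F.I nabla x / (1 + F.H x + F.Ke x)) ∧
        (∀ x, F.HStar x = -gaussCurvature F.IStar nablaStar x) ∧
        (∀ (X Y : VField S) (x : S), X.DiffAt x → Y.DiffAt x →
          extCovDeriv nablaStar F.BStar X Y x = 0) := by
  have hf : F.IsParallel F.f (fun _ ↦ 1) := F.isParallel_f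
  have hφ := F.isParallel_sub_normal
  have hone : ∀ x : S, IsUnit (1 : Tan x →L[ℝ] Tan x) := fun _ ↦ isUnit_one
  have hI : ∀ x u v, F.I x u v = 1 * lorentz (diff F.f x u) (diff F.f x v) := fun x u v ↦
    (one_mul _).symm
  have hIStar : ∀ x u v, F.IStar x u v = 1 / 2 *
      lorentz (diff (fun y ↦ F.f y - F.normal y) x u) (diff (fun y ↦ F.f y - F.normal y) x v) := by
    intro x u v
    rw [hφ.diff_eq, hφ.diff_eq]
    rfl
  obtain ⟨nabla₀, h₀⟩ := F.exists_isInducedConn_f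
  refine ⟨hφ.isSmoothMetric hF one_half_pos hIStar, ⟨nabla₀, h₀.isLeviCivita hf hone hI⟩, ?_⟩
  intro nabla hnabla
  have h := (h₀.of_isLeviCivita hf hone one_pos hI hnabla).1
  have hconj := h.conjConn hφ hF
  refine ⟨hconj.isLeviCivita hφ hF hIStar, ?_⟩
  intro nablaStar hnablaStar
  obtain ⟨hStar, heq⟩ := hconj.of_isLeviCivita hφ hF one_half_pos hIStar hnablaStar
  have hK := h.gaussCurvature_eq hf hone one_pos hI
  have hKStar := hStar.gaussCurvature_eq hφ hF one_half_pos hIStar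
  have hdet : ∀ x, 1 + F.H x + F.Ke x ≠ 0 := fun x ↦ by
    rw [← F.det_EaddB]
    exact ImmersedSurface.det_toLinearMap_ne_zero (hF x)
  refine ⟨heq, fun x ↦ ?_, fun x ↦ ?_, fun X Y x hX hY ↦
    hStar.extCovDeriv_eq_zero hφ hF F.isParallel_add_normal
      (fun y ↦ F.EaddB_mul_BStar (hF y)) hX hY⟩
  · have hdet1 : LinearMap.det (1 : Tan x →L[ℝ] Tan x).toLinearMap = 1 := LinearMap.det_id
    have := hdet x
    rw [hK, hKStar, F.det_EaddB, hdet1]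
    field_simp
  · have hH := F.det_EaddB_mul_HStar (hF x)
    have := hdet x
    rw [hKStar]
    rw [F.det_EaddB] at hH ⊢
    field_simp
    linear_combination hH
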